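/- Fix a background universe of sets. A \emph{model of set theory} is a transitive class $V$ with $(V,\in)\models\mathrm{ZFC}$. A \emph{distance monoid} is a commutative monoid $\mathcal W=(W,+,0,\le)$ with a linear order $\le$ that has least element $0$, such that $a\le b$ implies $c+a\le c+b$, and $b+\bigwedge A=\bigwedge_{a\in A}(a+b)$ for all $b \in W$ and all $A\subseteq W$ that have an infimum. It is \emph{complete} if every subset of $W$ has an infimum and a supremum. A \emph{$\mathcal W$-metric space} is a set $M$ with $d:M\times M\to W$ such that $d(x,y)\vee d(y,x)=0$ if and only if $x=y$, and $d(x,z)\le d(x,y)+d(y,z)$. A \emph{Cauchy sequence} is a map $p:A\to M$ with $A\subseteq W\setminus\{0\}$, $\bigwedge_{a,b\in A}(a+b)=0$ and $d(p(a),p(b))\le a+b$ for all $a,b\in A$. It \emph{converges} to $x$ if $\bigvee_{a\in W\setminus\{0\}}\bigwedge_{b\in A,\,b\le a}d(x,p(b))=0$ and $\bigvee_{a\in W\setminus\{0\}}\bigwedge_{b\in A,\,b\le a}d(p(b),x)=0$. A \emph{generalized dynamical system} is a triple $(\mathcal M,f,\mathcal W)$ where $\mathcal W$ is a complete distance monoid,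 $\mathcal M=(M,d)$ is a $\mathcal W$-metric space in which every Cauchy sequence converges to a point of $M$, and $f:M\to M$ satisfies $d(f(x),f(y))\le d(x,y)$ for all $x,y\in M$. It is regarded as a structure with two sorts $W$, $M$ in the language $\{+,0,\le,d,f\}$. It \emph{has a fixed point} if $f(x)=x$ for some $x\in M$. Let $V_0\subseteq V_1$ be models of set theory, and let $\mathcal S_0=(\mathcal M_0,f_0,\mathcal W_0)\in V_0$ be a generalized dynamical system in the sense of $V_0$. A structure $\mathcal S_1=(\mathcal M_1,f_1,\mathcal W_1)\in V_1$ is the \emph{relativization} of $\mathcal S_0$ to $V_1$ (for being a generalized dynamical system) if (a) $V_1\models$ "$\mathcal S_1$ is a generalized dynamical system"; (b) $W_0\subseteq W_1$, $M_0\subseteq M_1$, and the identity map is a homomorphism $\mathcal S_0\to\mathcal S_1$; (c) every embedding $\mathcal S_1\to\mathcal S_1$ in $V_1$ that is the identity on $\mathcal S_0$ is an automorphism; (d) for every $\mathcal S^*\in V_1$ that satisfies (a) and (b) in place of $\mathcal S_1$ there is a homomorphism $\mathcal S_1\to\mathcal S^*$ in $V_1$ that is the identity on $\mathcal S_0$.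 **Proposition.** Let $V_0\subseteq V_1$ be models of set theory, let $(\mathcal M_0,f_0,\mathcal W_0)\in V_0$ be a generalized dynamical system in the sense of $V_0$, and let $(\mathcal M_1,f_1,\mathcal W_1)\in V_1$ be its relativization to $V_1$ for being a generalized dynamical system. Then every fixed point of $(\mathcal M_0,f_0)$ in $V_0$ is a fixed point of $(\mathcal M_1,f_1)$ in $V_1$. In particular, if $(\mathcal M_0,f_0)$ has a fixed point, then so does $(\mathcal M_1,f_1)$. -/

import Mathlib

universe u v

/-! ### The language of set theory and transitive models of ZFC -/

/-- The relation symbols of the language of set theory: one binary symbol. -/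
inductive MemSymbol : ℕ → Type
  | mem : MemSymbol 2

/-- The first-order language of set theory. -/
def setLang : FirstOrder.Language := ⟨fun _ => Empty, MemSymbol⟩

/-- A type with a membership relation is a structure for the language of set theory. -/
instance setLangStructure (α : Type v) [Membership α α] : setLang.Structure α where
  funMap := fun f _ => Empty.elim f
  RelMap := fun {_} r => match r with
    | MemSymbol.mem => fun w => w 0 ∈ w 1

/-- `(α, ∈)` satisfies the axioms of Zermelo-Fraenkel set theory with choice. In the two schemes
`φ` ranges over the first-order formulas of the language of set theory, and `w` is the tuple of
parameters. -/
structure SatisfiesZFC (α : Type v) [Membership α α] : Prop where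
  extensionality : ∀ a b : α, (∀ x : α, x ∈ a ↔ x ∈ b) → a = b
  foundation : ∀ a : α, (∃ x : α, x ∈ a) → ∃ x : α, x ∈ a ∧ ¬ ∃ y : α, y ∈ x ∧ y ∈ a
  pairing : ∀ a b : α, ∃ c : α, ∀ x : α, x ∈ c ↔ x = a ∨ x = b
  union : ∀ a : α, ∃ b : α, ∀ x : α, x ∈ b ↔ ∃ y : α, y ∈ a ∧ x ∈ y
  powerset : ∀ a : α, ∃ b : α, ∀ x : α, x ∈ b ↔ ∀ y : α, y ∈ x → y ∈ a
  infinity : ∃ a : α, (∃ e : α, e ∈ a ∧ ∀ x : α, ¬ x ∈ e) ∧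
    ∀ x : α, x ∈ a → ∃ y : α, y ∈ a ∧ ∀ z : α, z ∈ y ↔ z ∈ x ∨ z = x
  separation : ∀ (n : ℕ) (φ : setLang.Formula (Fin (n + 1))) (w : Fin n → α) (a : α),
    ∃ b : α, ∀ x : α, x ∈ b ↔ x ∈ a ∧ φ.Realize (Fin.cons x w : Fin (n + 1) → α)
  replacement : ∀ (n : ℕ) (φ : setLang.Formula (Fin (n + 2))) (w : Fin n → α) (a : α),
    (∀ x : α, x ∈ a →
      ∃! y : α, φ.Realize (Fin.cons x (Fin.cons y w : Fin (n + 1) → α) : Fin (n + 2) → α)) →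
    ∃ b : α, ∀ y : α, y ∈ b ↔ ∃ x : α, x ∈ a ∧
      φ.Realize (Fin.cons x (Fin.cons y w : Fin (n + 1) → α) : Fin (n + 2) → α)
  choice : ∀ a : α, (∀ x : α, x ∈ a → ∃ y : α, y ∈ x) →
    (∀ x y : α, x ∈ a → y ∈ a → x ≠ y → ¬ ∃ z : α, z ∈ x ∧ z ∈ y) →
    ∃ c : α, ∀ x : α, x ∈ a → ∃! z : α, z ∈ x ∧ z ∈ c

/-- The elements of a class `V` of the background universe `ZFSet`. -/
def Elts (V : Set ZFSet.{u}) : Type (u + 1) := {x : ZFSet.{u} // x ∈ V}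

/-- The structure `(V, ∈)`. A property of `Elts V` that is expressed through this membership
relation and quantifiers over `Elts V` is the property as evaluated in the model `V`. -/
instance eltsMembership (V : Set ZFSet.{u}) : Membership (Elts V) (Elts V) :=
  ⟨fun y x => x.1 ∈ y.1⟩

/-- The inclusion of a class into a larger class. -/
def Elts.incl {V₀ V₁ : Set ZFSet.{u}} (h : V₀ ⊆ V₁) (x : Elts V₀) : Elts V₁ := ⟨x.1, h x.2⟩

/-- A model of set theory: a transitive class `V` with `(V, ∈) ⊨ ZFC`. -/
structure IsModelOfSetTheory (V : Set ZFSet.{u}) : Prop where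
  transitive : ∀ x ∈ V, ∀ y ∈ x, y ∈ V
  zfc : SatisfiesZFC (Elts V)

/-! ### Pairs and functions, evaluated in a model `(α, ∈)` -/

section Internal

variable {α : Type v} [Membership α α]

/-- `z = {x, y}`. -/
def IsUPair (z x y : α) : Prop := ∀ w : α, w ∈ z ↔ w = x ∨ w = y

/-- `p = (x, y) = {{x}, {x, y}}`. -/
def IsOPair (p x y : α) : Prop := ∃ s t : α, IsUPair s x x ∧ IsUPair t x y ∧ IsUPair p s t

/-- `(x, y) ∈ r`; for a function `r` this says `r x = y`. -/
def App (r x y : α) : Prop := ∃ p : α, IsOPair p x y ∧ p ∈ r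

/-- `((x, y), z) ∈ r`; for a function `r` of two variables this says `r (x, y) = z`. -/
def App₂ (r x y z : α) : Prop := ∃ q : α, IsOPair q x y ∧ App r q z

/-- `a ⊆ b`. -/
def Subs (a b : α) : Prop := ∀ x : α, x ∈ a → x ∈ b

/-- `r ⊆ A × B`. -/
def IsRelOn (r A B : α) : Prop :=
  ∀ p : α, p ∈ r → ∃ x y : α, x ∈ A ∧ y ∈ B ∧ IsOPair p x y

/-- `f` is a function from `A` to `B`. -/
def IsFun (f A B : α) : Prop := IsRelOn f A B ∧ ∀ x : α, x ∈ A → ∃! y : α, App f x y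

/-- `f` is a function from `A × B` to `C`. -/
def IsFun₂ (f A B C : α) : Prop :=
  (∀ p : α, p ∈ f → ∃ x y z q : α, x ∈ A ∧ y ∈ B ∧ z ∈ C ∧ IsOPair q x y ∧ IsOPair p q z) ∧
  ∀ x y : α, x ∈ A → y ∈ B → ∃! z : α, App₂ f x y z

end Internal

/-! ### Generalized dynamical systems, evaluated in a model `(α, ∈)` -/

/-- The data of a structure in `α` for the two-sorted language with a sort of distances carrying
`+`, `0`, `≤`, a sort of points, a function symbol for the distance between two points, and a
function symbol for a map from points to points. -/
structure DynStr (α : Type v) where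
  /-- the underlying set of distances -/
  W : α
  /-- the underlying set of points -/
  M : α
  /-- addition of distances -/
  plus : α
  /-- the distance zero -/
  zero : α
  /-- the order of the distances -/
  le : α
  /-- the distance function -/
  dist : α
  /-- the map on points -/
  f : α

namespace DynStr

/-- A structure in `V₀` regarded as a structure in a larger class `V₁`. -/
def incl {V₀ V₁ : Set ZFSet.{u}} (h : V₀ ⊆ V₁) (S : DynStr (Elts V₀)) : DynStr (Elts V₁) where
  W := S.W.incl h
  M := S.M.incl h
  plus := S.plus.incl h
  zero := S.zero.incl h
  le := S.le.incl h
  dist := S.dist.incl h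
  f := S.f.incl h

variable {α : Type v} [Membership α α] (S T : DynStr α)

/-- `a + b = c`. -/
def Add (a b c : α) : Prop := App₂ S.plus a b c

/-- `a ≤ b`. -/
def Le (a b : α) : Prop := App S.le a b

/-- `d(x, y) = a`. -/
def Dist (x y a : α) : Prop := App₂ S.dist x y a

/-- `f(x) = y`. -/
def Maps (x y : α) : Prop := App S.f x y

/-- `S` is a structure for the language: each symbol is interpreted by an object of the
right arity. -/
structure IsStr : Prop where
  plus : IsFun₂ S.plus S.W S.W S.W
  zero : S.zero ∈ S.W
  le : IsRelOn S.le S.W S.W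
  dist : IsFun₂ S.dist S.M S.M S.W
  f : IsFun S.f S.M S.M

/-- `m` is the infimum in `W` of the distances with property `Q`. -/
def IsInf (Q : α → Prop) (m : α) : Prop :=
  m ∈ S.W ∧ (∀ a : α, Q a → S.Le m a) ∧
    ∀ l : α, l ∈ S.W → (∀ a : α, Q a → S.Le l a) → S.Le l m

/-- `m` is the supremum in `W` of the distances with property `Q`. -/
def IsSup (Q : α → Prop) (m : α) : Prop :=
  m ∈ S.W ∧ (∀ a : α, Q a → S.Le a m) ∧
    ∀ l : α, l ∈ S.W → (∀ a : α, Q a → S.Le a l) → S.Le m l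

/-- `(W, +, 0, ≤)` is a distance monoid: a commutative monoid with a linear order that has minimum
`0` and is translation invariant, in which `b + ⋀ A = ⋀ {a + b : a ∈ A}` for every set `A ⊆ W` of
the model that has an infimum. -/
structure IsDistMonoid : Prop where
  add_comm : ∀ a b c : α, S.Add a b c → S.Add b a c
  add_assoc : ∀ a b c ab bc s : α, S.Add a b ab → S.Add b c bc → S.Add ab c s → S.Add a bc s
  zero_add : ∀ a : α, a ∈ S.W → S.Add S.zero a a
  le_refl : ∀ a : α, a ∈ S.W → S.Le a a
  le_trans : ∀ a b c : α, S.Le a b → S.Le b c → S.Le a c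
  le_antisymm : ∀ a b : α, S.Le a b → S.Le b a → a = b
  le_total : ∀ a b : α, a ∈ S.W → b ∈ S.W → S.Le a b ∨ S.Le b a
  zero_le : ∀ a : α, a ∈ S.W → S.Le S.zero a
  add_le_add : ∀ a b c s t : α, S.Le a b → S.Add c a s → S.Add c b t → S.Le s t
  add_inf : ∀ A b m s : α, Subs A S.W → S.IsInf (fun a => a ∈ A) m → S.Add b m s →
    S.IsInf (fun t => ∃ a : α, a ∈ A ∧ S.Add a b t) s

/-- `(W, ≤)` is a complete linear order: each subset of `W` in the model has an infimum and a
supremum. -/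
def IsCompleteOrder : Prop :=
  ∀ A : α, Subs A S.W → (∃ m : α, S.IsInf (fun a => a ∈ A) m) ∧ ∃ m : α, S.IsSup (fun a => a ∈ A) m

/-- `(M, d)` is a `W`-metric space (the distance need not be symmetric). As `0` is the minimum of
`W`, the join of two distances is `0` if and only if both are `0`. -/
structure IsMetric : Prop where
  eq_iff : ∀ x y : α, x ∈ S.M → y ∈ S.M → ((S.Dist x y S.zero ∧ S.Dist y x S.zero) ↔ x = y)
  triangle : ∀ x y z a b c s : α, S.Dist x z a → S.Dist x y b → S.Dist y z c → S.Add b c s →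
    S.Le a s

/-- `p` is a Cauchy sequence with domain `A`: a function `p : A → M` where `A ⊆ W \ {0}` is such
that `⋀ {a + b : a, b ∈ A} = 0`, and `d(p(a), p(b)) ≤ a + b` for all `a, b ∈ A`. -/
structure IsCauchy (A p : α) : Prop where
  dom_sub : ∀ a : α, a ∈ A → a ∈ S.W ∧ a ≠ S.zero
  dom_inf : S.IsInf (fun s => ∃ a b : α, a ∈ A ∧ b ∈ A ∧ S.Add a b s) S.zero
  isFun : IsFun p A S.M
  dist_le : ∀ a b x y e s : α, a ∈ A → b ∈ A → App p a x → App p b y → S.Dist x y e →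
    S.Add a b s → S.Le e s

/-- `p`, with domain `A`, converges to `x`: the supremum over `a ∈ W \ {0}` of the infimum over
`b ∈ A`, `b ≤ a`, of `d(x, p(b))` is `0`, and the same holds for `d(p(b), x)`. -/
def ConvergesTo (A p x : α) : Prop :=
  S.IsSup (fun m => ∃ a : α, a ∈ S.W ∧ a ≠ S.zero ∧
    S.IsInf (fun e => ∃ b y : α, b ∈ A ∧ S.Le b a ∧ App p b y ∧ S.Dist x y e) m) S.zero ∧
  S.IsSup (fun m => ∃ a : α, a ∈ S.W ∧ a ≠ S.zero ∧
    S.IsInf (fun e => ∃ b y : α, b ∈ A ∧ S.Le b a ∧ App p b y ∧ S.Dist y x e) m) S.zero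

/-- Each Cauchy sequence of the model converges to a point. -/
def IsCauchyComplete : Prop :=
  ∀ A p : α, S.IsCauchy A p → ∃ x : α, x ∈ S.M ∧ S.ConvergesTo A p x

/-- `f` is non-expanding: `d(f(x), f(y)) ≤ d(x, y)`. -/
def IsNonExpanding : Prop :=
  ∀ x y x' y' a a' : α, S.Maps x x' → S.Maps y y' → S.Dist x y a → S.Dist x' y' a' → S.Le a' a

/-- `S` is a generalized dynamical system in the sense of the model `(α, ∈)`: a complete distance
monoid `W`, a Cauchy complete `W`-metric space `M` and a non-expanding map `f : M → M`. -/
structure IsGenDynSystem : Prop where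
  isStr : S.IsStr
  isDistMonoid : S.IsDistMonoid
  isCompleteOrder : S.IsCompleteOrder
  isMetric : S.IsMetric
  isCauchyComplete : S.IsCauchyComplete
  isNonExpanding : S.IsNonExpanding

/-- `x` is a fixed point of `S`: `x ∈ M` and `f(x) = x`. -/
def IsFixedPoint (x : α) : Prop := x ∈ S.M ∧ S.Maps x x

/-- `S` has a fixed point in the sense of the model. -/
def HasFixedPoint : Prop := ∃ x : α, S.IsFixedPoint x

/-! ### Homomorphisms and relativization -/

/-- The maps with graphs `G` (on distances) and `H` (on points) preserve the symbols of the
language. -/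
structure Preserves (G H : α → α → Prop) : Prop where
  zero : G S.zero T.zero
  plus : ∀ a b c a' b' c' : α, S.Add a b c → G a a' → G b b' → G c c' → T.Add a' b' c'
  le : ∀ a b a' b' : α, S.Le a b → G a a' → G b b' → T.Le a' b'
  dist : ∀ x y a x' y' a' : α, S.Dist x y a → H x x' → H y y' → G a a' → T.Dist x' y' a'
  f : ∀ x y x' y' : α, S.Maps x y → H x x' → H y y' → T.Maps x' y'

/-- The pair of functions `g` (on distances) and `h` (on points) is a homomorphism from `S`
to `T`. -/
structure IsHom (g h : α) : Prop where
  isFun_g : IsFun g S.W T.W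
  isFun_h : IsFun h S.M T.M
  preserves : S.Preserves T (App g) (App h)

/-- An embedding: an injective homomorphism that also reflects the relation `≤`. -/
structure IsEmbedding (g h : α) : Prop where
  isHom : S.IsHom T g h
  injective_g : ∀ a b c : α, App g a c → App g b c → a = b
  injective_h : ∀ x y z : α, App h x z → App h y z → x = y
  reflects_le : ∀ a b a' b' : α, App g a a' → App g b b' → T.Le a' b' → S.Le a b

/-- An automorphism: a surjective embedding of `S` into itself. -/
structure IsAutomorphism (g h : α) : Prop where
  isEmbedding : S.IsEmbedding S g h
  surjective_g : ∀ b : α, b ∈ S.W → ∃ a : α, App g a b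
  surjective_h : ∀ y : α, y ∈ S.M → ∃ x : α, App h x y

/-- `S` is a (not necessarily induced) substructure of `T`: the underlying sets of `S` are
contained in those of `T` and the identity map is a homomorphism. -/
structure IsSubstructure : Prop where
  sub_W : Subs S.W T.W
  sub_M : Subs S.M T.M
  preserves : S.Preserves T (fun a b => a = b) (fun x y => x = y)

/-- The pair of functions `g`, `h` is the identity on the underlying sets of `S`. -/
def IsIdOn (g h : α) : Prop :=
  (∀ a : α, a ∈ S.W → App g a a) ∧ ∀ x : α, x ∈ S.M → App h x x

end DynStr

/-- For classes `V₀ ⊆ V₁`, the structure `N` in `V₁` is the relativization to `V₁`, with respect to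
being a generalized dynamical system, of the structure `S` in `V₀`. -/
structure IsRelativization {V₀ V₁ : Set ZFSet.{u}} (h : V₀ ⊆ V₁)
    (S : DynStr (Elts V₀)) (N : DynStr (Elts V₁)) : Prop where
  /-- `V₁` satisfies that `N` is a generalized dynamical system. -/
  target : N.IsGenDynSystem
  /-- `S` is a substructure of `N`. -/
  substructure : (S.incl h).IsSubstructure N
  /-- Each embedding of `N` into itself that is the identity on `S` is an automorphism. -/
  rigid : ∀ i j : Elts V₁, N.IsEmbedding N i j → (S.incl h).IsIdOn i j → N.IsAutomorphism i j
  /-- `N` maps to each generalized dynamical system in `V₁` that contains `S`. -/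
  minimal : ∀ N' : DynStr (Elts V₁), N'.IsGenDynSystem → (S.incl h).IsSubstructure N' →
    ∃ i j : Elts V₁, N.IsHom N' i j ∧ (S.incl h).IsIdOn i j

/-! ### Upward absoluteness of pairs and application between transitive classes -/

section Absoluteness

variable {V₀ V₁ : Set ZFSet.{u}}

/-! A fixed point is an atomic fact: `x ∈ M` and `(x, x) ∈ f`. Such facts pass upward twice. From
`V₀` to `V₁`, membership is literally the same relation on sets, so the only thing to check is that
the coding of ordered pairs keeps its meaning; this is absoluteness of a bounded notion between
transitive classes, and `IsUPair.incl` carries it. From `S₀`, now read in `V₁`, to `S₁`, the fact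
passes because the identity is a homomorphism, so that the graph of the old map is respected by the
new one (`DynStr.IsSubstructure.isFixedPoint`). The relativization enters through its field
`substructure`. -/

/-- Unordered pairs of a transitive class remain unordered pairs in a larger class. -/
theorem IsUPair.incl (hV₀ : ∀ x ∈ V₀, ∀ y ∈ x, y ∈ V₀) (hV : V₀ ⊆ V₁) {z x y : Elts V₀}
    (h : IsUPair z x y) : IsUPair (z.incl hV) (x.incl hV) (y.incl hV) := by
  intro w
  constructor
  · intro hw
    -- Transitivity of `V₀` is essential here: the quantifier over `w` now ranges over `V₁`, and a
    -- set of `V₀` must not acquire elements outside `V₀`.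
    have hw₀ : w.1 ∈ V₀ := hV₀ z.1 z.2 w.1 hw
    rcases (h ⟨w.1, hw₀⟩).1 hw with e | e
    -- `Elts.incl hV ⟨w.1, hw₀⟩` is `w` itself by eta and proof irrelevance, so applying the
    -- inclusion to `e` gives the equation in `V₁`.
    · exact Or.inl (congrArg (Elts.incl hV) e)
    · exact Or.inr (congrArg (Elts.incl hV) e)
  · rintro (rfl | rfl)
    · exact (h x).2 (Or.inl rfl)
    · exact (h y).2 (Or.inr rfl)

/-- Ordered pairs of a transitive class remain ordered pairs in a larger class. -/
theorem IsOPair.incl (hV₀ : ∀ x ∈ V₀, ∀ y ∈ x, y ∈ V₀) (hV : V₀ ⊆ V₁) {p x y : Elts V₀}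
    (h : IsOPair p x y) : IsOPair (p.incl hV) (x.incl hV) (y.incl hV) := by
  obtain ⟨s, t, hs, ht, hp⟩ := h
  -- The sets `{x}` and `{x, y}` found in `V₀` still serve as witnesses in `V₁`; only this upward
  -- direction is needed.
  exact ⟨s.incl hV, t.incl hV, hs.incl hV₀ hV, ht.incl hV₀ hV, hp.incl hV₀ hV⟩

/-- The values of a function of a transitive class are the same in a larger class. -/
theorem App.incl (hV₀ : ∀ x ∈ V₀, ∀ y ∈ x, y ∈ V₀) (hV : V₀ ⊆ V₁) {r x y : Elts V₀}
    (h : App r x y) : App (r.incl hV) (x.incl hV) (y.incl hV) := by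
  obtain ⟨p, hp, hr⟩ := h
  -- `hr` is reused unchanged, since membership in both classes unfolds to membership of the
  -- underlying sets.
  exact ⟨p.incl hV, hp.incl hV₀ hV, hr⟩

/-- A fixed point of a structure of a transitive class is a fixed point of the same structure
in a larger class. -/
theorem DynStr.IsFixedPoint.incl (hV₀ : ∀ x ∈ V₀, ∀ y ∈ x, y ∈ V₀) (hV : V₀ ⊆ V₁)
    {S : DynStr (Elts V₀)} {x : Elts V₀} (h : S.IsFixedPoint x) :
    (S.incl hV).IsFixedPoint (x.incl hV) :=
  ⟨h.1, App.incl hV₀ hV h.2⟩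

end Absoluteness

/-- A fixed point of a substructure is a fixed point of the structure. -/
theorem DynStr.IsSubstructure.isFixedPoint {α : Type v} [Membership α α] {S T : DynStr α}
    (hST : S.IsSubstructure T) {x : α} (h : S.IsFixedPoint x) : T.IsFixedPoint x :=
  -- The homomorphism has equality as its graph on points, so both `rfl` say that `x` is sent to
  -- `x`.
  ⟨hST.sub_M x h.1, hST.preserves.f x x x x h.2 rfl rfl⟩

theorem mainTheorem4 (V₀ V₁ : Set ZFSet.{u})
    (hV₀ : IsModelOfSetTheory V₀) (hV₁ : IsModelOfSetTheory V₁) (hV : V₀ ⊆ V₁)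
    (S₀ : DynStr (Elts V₀)) (S₁ : DynStr (Elts V₁))
    (hS₀ : S₀.IsGenDynSystem) (hS₁ : IsRelativization hV S₀ S₁) :
    (∀ x : Elts V₀, S₀.IsFixedPoint x → S₁.IsFixedPoint (x.incl hV)) ∧
      (S₀.HasFixedPoint → S₁.HasFixedPoint) := by
  have key : ∀ x : Elts V₀, S₀.IsFixedPoint x → S₁.IsFixedPoint (x.incl hV) := fun x hx =>
    -- The inner term moves the fixed point from `V₀` to `V₁` within the same structure; the outer
    -- one moves it from that structure to `S₁` inside `V₁`.
    hS₁.substructure.isFixedPoint (hx.incl hV₀.transitive hV)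
  exact ⟨key, fun ⟨x, hx⟩ => ⟨x.incl hV, key x hx⟩⟩
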